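/- Let $q$ be a prime power, let $m\ge 1$ and $n\le m$. For $x\in \mathrm{GF}(q^m)^n$ let $\mathrm{rk}(x)$ be the rank of the $m\times n$ matrix over $\mathrm{GF}(q)$ whose columns are the coordinate vectors of the entries of $x$ with respect to a basis of $\mathrm{GF}(q^m)$ over $\mathrm{GF}(q)$, and let $d(x,y)=\mathrm{rk}(x-y)$ be the rank distance. Let $C\subseteq \mathrm{GF}(q^m)^n$ be a (linear or nonlinear) maximum rank distance (MRD) code, that is, a code whose minimum rank distance $d_R$, the least rank distance between two distinct codewords, attains the Singleton bound: $d_R = n-\log_{q^m}|C|+1$. Suppose that $d_R=2t+1$. A bounded rank distance decoder for $C$ outputs, for a received word $y$, a codeword within rank distance $t$ of $y$ if there is one, and declares a failure otherwise. Suppose that a codeword $c\in C$ is transmitted and $c+e$ is received, where the random error $e\in \mathrm{GF}(q^m)^n$ has any distribution under which vectors of equal rank have equal probability. Let $P_E(t)$ be the decoder error probability, that is, the probability that the decoder outputs a codeword different from $c$. Then $$P_E(t) < K_q^{-2}\, q^{-t^2},\qquad K_q=\prod_{j=1}^{\infty}\left(1-q^{-j}\right),$$ for every such code, decoder, transmitted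 codeword and error distribution; in particular the bound does not depend on the rank of the error. -/

import Mathlib

/-- The rank norm of `x ∈ L^n` over `F`: the rank of the `m × n` matrix over `F` whose `j`-th column
is the coordinate vector of `x j` with respect to a basis of `L` over `F`
(any basis gives the same value, see `rankNorm_eq_rank_toMatrix`). -/
noncomputable def rankNorm (F : Type*) {L : Type*} [Field F] [Field L] [Finite L] [Algebra F L]
    {n : ℕ} (x : Fin n → L) : ℕ :=
  ((Module.finBasis F L).toMatrix x).rank

theorem rank_toMatrix_eq_finrank_span {F L ι : Type*} [Field F] [Field L]
    [Algebra F L] [Fintype ι] (b : Module.Basis ι F L) {n : ℕ} (x : Fin n → L) :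
    (b.toMatrix x).rank = Module.finrank F (Submodule.span F (Set.range x)) := by
  have h : Set.range (b.toMatrix x).col = b.equivFun '' Set.range x := by
    rw [← Set.range_comp]; rfl
  rw [Matrix.rank_eq_finrank_span_cols, h]
  exact (congrArg (fun S : Submodule F (ι → F) => Module.finrank F S)
    (Submodule.span_image (b.equivFun : L →ₗ[F] ι → F))).trans
    (LinearEquiv.finrank_map_eq b.equivFun _)

theorem rankNorm_eq_rank_toMatrix {F L ι : Type*} [Field F] [Field L] [Finite L]
    [Algebra F L] [Fintype ι] (b : Module.Basis ι F L) {n : ℕ} (x : Fin n → L) :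
    rankNorm F x = (b.toMatrix x).rank := by
  rw [rankNorm, rank_toMatrix_eq_finrank_span, rank_toMatrix_eq_finrank_span]

/-- The rank distance on `L^n`. -/
noncomputable def rankDist (F : Type*) {L : Type*} [Field F] [Field L] [Finite L] [Algebra F L]
    {n : ℕ} (x y : Fin n → L) : ℕ :=
  rankNorm F (x - y)

/-- The minimum rank distance of a (linear or nonlinear) code: the least rank distance between two
distinct codewords. The value is `0` exactly when there are no two distinct codewords. -/
noncomputable def minRankDist (F : Type*) {L : Type*} [Field F] [Field L] [Finite L] [Algebra F L]
    {n : ℕ} (C : Set (Fin n → L)) : ℕ :=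
  sInf {d | ∃ x ∈ C, ∃ y ∈ C, x ≠ y ∧ d = rankDist F x y}

/-- A (linear or nonlinear) code of length `n` over `L = GF(q^m)` is a maximum rank distance (MRD)
code if it attains the Singleton bound `d ≤ n - log_{q^m} |C| + 1`. Here `q^m = |L|`. -/
def IsMRD (F : Type*) {L : Type*} [Field F] [Field L] [Finite L] [Algebra F L]
    {n : ℕ} (C : Set (Fin n → L)) : Prop :=
  (minRankDist F C : ℝ) = (n : ℝ) - Real.logb (Nat.card L : ℝ) (C.ncard : ℝ) + 1

/-- A bounded rank distance decoder of radius `t` for the code `C`: on the received word `y` it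
outputs a codeword within rank distance `t` of `y` if there is one (`some c`), and declares a
failure (`none`) otherwise. -/
def IsBoundedRankDistanceDecoder (F : Type*) {L : Type*} [Field F] [Field L] [Finite L]
    [Algebra F L] {n : ℕ} (C : Set (Fin n → L)) (t : ℕ)
    (dec : (Fin n → L) → Option (Fin n → L)) : Prop :=
  (∀ y c, dec y = some c → c ∈ C ∧ rankDist F y c ≤ t) ∧
  (∀ y, dec y = none → ∀ c ∈ C, ¬ rankDist F y c ≤ t)

/-- The decoder error probability: the probability, when `c` is transmitted and an additive error
`e` with law `p` occurs, that the decoder outputs an estimate different from `c`.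
A decoder failure (`none`) is not a decoder error. -/
noncomputable def decoderErrorProb {L : Type*} [Field L] {n : ℕ}
    (dec : (Fin n → L) → Option (Fin n → L)) (p : PMF (Fin n → L)) (c : Fin n → L) : ℝ :=
  (p.toOuterMeasure {e | ∃ c', dec (c + e) = some c' ∧ c' ≠ c}).toReal

/-- `K_q = ∏_{j ≥ 1} (1 - q^{-j})`. -/
noncomputable def rankConst (q : ℕ) : ℝ :=
  ∏' j : ℕ, (1 - ((q : ℝ) ^ (j + 1))⁻¹)

/-!
A word `x ∈ L ^ n` is read as the `F`-linear map `F ^ n → L` sending the standard basis to the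
entries of `x` (`wordEquiv`); its rank norm is then the rank of this map. Put `q = |F|` and
`m = dim L`. An error law that is constant on vectors of equal rank is constant on errors with the
same kernel, so it suffices (`PMF.toReal_toOuterMeasure_le_of_fibers`) to bound, for each subspace
`K` of `F ^ n`, the fraction of the maps with kernel exactly `K` that lead to a wrong codeword.

Let `K` have codimension `u`. There are at least `∏_{j=1}^{m} (1 - q^{-j}) · q^{mu}` maps with
kernel `K`, one for each linearly independent `u`-tuple in `L` (`prod_le_ncard_ker_eq`,
`truncRankConst_mul_le_prod`). On the other hand, let `E` be a subspace of codimension `t`. If `y`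
vanishes on `K` and `c₀ + y` agrees on `E` with a codeword other than `c₀`, then `y` is determined
by its values on a suitable subspace of dimension at most `u - t`: two such `y` that agree there
have codewords whose difference vanishes on a subspace of codimension at most `2t`, so the
codewords are equal by the minimum distance, and then so are the two errors. Hence there are at most
`q^{m(u-t)}` such `y` (`card_vanishing_decodable_mul_le`), and none if `u < t`. Every
error `y` that is decoded wrongly is such that `c₀ + y` agrees with a codeword other than `c₀` on
the kernel of a linear map onto `F ^ t`; there are at most `q^{nt}` such maps, and at
least `∏_{j=1}^{t} (1 - q^{-j}) · q^{t²}` of them serve a given `y`. Counting pairs in two ways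
(`card_decodable_mul_le`) and using `n ≤ m` gives the fraction
`(∏_{j=1}^{m} (1 - q^{-j}))⁻² q^{-t²}` (`card_decodable_ker_eq_le`). The strict inequality holds
because the infinite product `K_q` is positive and strictly smaller than its truncations
(`rankConst_pos`, `rankConst_lt_truncRankConst`).
-/

/-! ### Subspaces in general position -/

theorem Submodule.exists_le_finrank_eq {F V : Type*} [Field F] [AddCommGroup V] [Module F V]
    [FiniteDimensional F V] (U : Submodule F V) {d : ℕ} (hd : d ≤ Module.finrank F U) :
    ∃ T ≤ U, Module.finrank F T = d := by
  obtain ⟨v, hv⟩ := exists_linearIndependent_of_le_finrank hd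
  have hv' : LinearIndependent F fun i => (v i : V) := hv.map' U.subtype U.ker_subtype
  refine ⟨Submodule.span F (Set.range fun i => (v i : V)), ?_, ?_⟩
  · rw [Submodule.span_le]
    rintro _ ⟨i, rfl⟩
    exact (v i).2
  · simpa using finrank_span_eq_card hv'

/-- If `K` and `E` have codimensions `u` and `t` and do not meet in more than dimension `n - 2t`,
then `K` can be enlarged by a subspace of dimension at most `u - t` to one of dimension at least
`n - t` that spans the whole space together with `E`. -/
theorem exists_sup_sup_eq_top {F V : Type*} [Field F] [AddCommGroup V] [Module F V]
    [FiniteDimensional F V] (K E : Submodule F V) {u t : ℕ}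
    (hK : Module.finrank F K + u = Module.finrank F V)
    (hE : Module.finrank F E + t = Module.finrank F V)
    (hKE : Module.finrank F ↥(K ⊓ E) + 2 * t ≤ Module.finrank F V) :
    ∃ T : Submodule F V, Module.finrank F T + t ≤ u ∧
      Module.finrank F V ≤ Module.finrank F ↥(K ⊔ T) + t ∧ K ⊔ T ⊔ E = ⊤ := by
  have h1 := Submodule.finrank_sup_add_finrank_inf_eq K E
  obtain ⟨R, hR⟩ := Submodule.exists_isCompl (K ⊔ E)
  have h2 := Submodule.finrank_add_eq_of_isCompl hR
  have h3 : K ⊓ R = ⊥ :=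
    le_bot_iff.1 ((inf_le_inf_right R le_sup_left).trans hR.inf_eq_bot.le)
  have h4 := Submodule.finrank_sup_add_finrank_inf_eq K R
  rw [h3, finrank_bot] at h4
  obtain ⟨Q, hQ⟩ := Submodule.exists_isCompl (K ⊔ R)
  have h5 := Submodule.finrank_add_eq_of_isCompl hQ
  obtain ⟨T, hTQ, hT⟩ := Q.exists_le_finrank_eq
    (d := u - t - Module.finrank F R) (by omega)
  have h6 : (K ⊔ R) ⊓ T = ⊥ :=
    le_bot_iff.1 ((inf_le_inf_left _ hTQ).trans hQ.inf_eq_bot.le)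
  have h7 := Submodule.finrank_sup_add_finrank_inf_eq (K ⊔ R) T
  rw [h6, finrank_bot] at h7
  have h8 := Submodule.finrank_add_le_finrank_add_finrank R T
  refine ⟨R ⊔ T, by omega, by rw [← sup_assoc]; omega, top_le_iff.1 ?_⟩
  rw [← hR.sup_eq_top]
  exact sup_le (sup_le (le_sup_left.trans le_sup_left) le_sup_right)
    ((le_sup_left.trans le_sup_right).trans le_sup_left)

theorem LinearMap.finrank_range_add_le_of_le_ker {F V L : Type*} [Field F] [AddCommGroup V]
    [Module F V] [FiniteDimensional F V] [AddCommGroup L] [Module F L] (f : V →ₗ[F] L)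
    {W : Submodule F V} (h : W ≤ LinearMap.ker f) :
    Module.finrank F (LinearMap.range f) + Module.finrank F W ≤ Module.finrank F V := by
  have h1 := f.finrank_range_add_finrank_ker
  have h2 := Submodule.finrank_mono h
  omega

/-! ### Decodable words with prescribed kernels -/

/-- Among the errors `y` that vanish on a subspace `K` of codimension `u`, a fraction of at most
`|L| ^ (-t)` are carried by the codeword `c₀` to a word that differs from another codeword only by
a map vanishing on a given subspace `E` of codimension `t`. -/
theorem card_vanishing_decodable_mul_le {F V L : Type*} [Field F] [AddCommGroup V] [Module F V]
    [FiniteDimensional F V] [AddCommGroup L] [Module F L] [Finite F] [Finite L]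
    (C : Set (V →ₗ[F] L)) {t u : ℕ}
    (hC : ∀ x ∈ C, ∀ y ∈ C, x ≠ y → 2 * t + 1 ≤ Module.finrank F (LinearMap.range (x - y)))
    {c₀ : V →ₗ[F] L} (hc₀ : c₀ ∈ C) (K E : Submodule F V)
    (hK : Module.finrank F K + u = Module.finrank F V)
    (hE : Module.finrank F E + t = Module.finrank F V) :
    {y : V →ₗ[F] L | K ≤ LinearMap.ker y ∧
      ∃ c ∈ C, c ≠ c₀ ∧ E ≤ LinearMap.ker (c₀ + y - c)}.ncard * Nat.card L ^ t
      ≤ Nat.card L ^ u := by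
  set Y := {y : V →ₗ[F] L | K ≤ LinearMap.ker y ∧
      ∃ c ∈ C, c ≠ c₀ ∧ E ≤ LinearMap.ker (c₀ + y - c)}
  have : FiniteDimensional F L := Module.Finite.of_finite
  rcases Y.eq_empty_or_nonempty with h0 | ⟨y, hyK, c, hc, hcc, hyE⟩
  · simp [h0]
  -- `c - c₀` vanishes on `K ⊓ E`, so this intersection is small.
  have hKE : Module.finrank F ↥(K ⊓ E) + 2 * t ≤ Module.finrank F V := by
    have h1 : K ⊓ E ≤ LinearMap.ker (c - c₀) := by
      rintro v ⟨hv1, hv2⟩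
      have a := LinearMap.mem_ker.1 (hyK hv1)
      have b := LinearMap.mem_ker.1 (hyE hv2)
      simp only [LinearMap.sub_apply, LinearMap.add_apply, a, add_zero] at b
      rw [LinearMap.mem_ker, LinearMap.sub_apply, ← neg_sub, b, neg_zero]
    have h2 := LinearMap.finrank_range_add_le_of_le_ker _ h1
    have h3 := hC c hc c₀ hc₀ hcc
    omega
  obtain ⟨T, hT1, hT2, hT3⟩ := exists_sup_sup_eq_top K E hK hE hKE
  have hinf := Submodule.finrank_sup_add_finrank_inf_eq (K ⊔ T) E
  rw [hT3, finrank_top] at hinf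
  -- A word of `Y` is determined by its restriction to `T`.
  have hinj : Set.InjOn (fun y : V →ₗ[F] L => y.domRestrict T) Y := by
    rintro y ⟨hyK, c, hc, -, hyE⟩ y' ⟨hyK', c', hc', -, hyE'⟩ hyy
    have hKT : K ⊔ T ≤ LinearMap.ker (y - y') := by
      refine sup_le (fun v hv => ?_) (fun v hv => ?_)
      · rw [LinearMap.mem_ker, LinearMap.sub_apply, LinearMap.mem_ker.1 (hyK hv),
          LinearMap.mem_ker.1 (hyK' hv), sub_zero]
      · rw [LinearMap.mem_ker, LinearMap.sub_apply, sub_eq_zero]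
        exact LinearMap.congr_fun hyy ⟨v, hv⟩
    have key : ∀ v ∈ E, y v - y' v = c v - c' v := by
      intro v hv
      have a := LinearMap.mem_ker.1 (hyE hv)
      have b := LinearMap.mem_ker.1 (hyE' hv)
      simp only [LinearMap.sub_apply, LinearMap.add_apply] at a b
      rw [sub_eq_sub_iff_sub_eq_sub, ← add_right_inj (c₀ v), ← add_sub_assoc, a,
        ← add_sub_assoc, b]
    have hcc : c = c' := by
      by_contra hne
      have h1 : (K ⊔ T) ⊓ E ≤ LinearMap.ker (c - c') := by
        rintro v ⟨hv1, hv2⟩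
        have a := LinearMap.mem_ker.1 (hKT hv1)
        rw [LinearMap.sub_apply, key v hv2] at a
        exact a
      have h2 := LinearMap.finrank_range_add_le_of_le_ker _ h1
      have h3 := hC c hc c' hc' hne
      omega
    subst hcc
    have hE' : E ≤ LinearMap.ker (y - y') := fun v hv => by
      rw [LinearMap.mem_ker, LinearMap.sub_apply, key v hv, sub_self]
    rw [← sub_eq_zero, ← LinearMap.ker_eq_top, ← top_le_iff, ← hT3]
    exact sup_le hKT hE'
  have hfin : Finite (T →ₗ[F] L) := Module.finite_of_finite F
  have hcard : Nat.card (T →ₗ[F] L) = Nat.card L ^ Module.finrank F T := by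
    rw [Module.natCard_eq_pow_finrank (K := F), Module.natCard_eq_pow_finrank (K := F) (V := L),
      Module.finrank_linearMap, ← pow_mul, mul_comm]
  calc Y.ncard * Nat.card L ^ t ≤ Nat.card L ^ Module.finrank F T * Nat.card L ^ t := by
        rw [← hcard, ← hinj.ncard_image]
        exact Nat.mul_le_mul_right _ (Set.ncard_le_card _)
    _ = Nat.card L ^ (Module.finrank F T + t) := (pow_add _ _ _).symm
    _ ≤ Nat.card L ^ u := Nat.pow_le_pow_right Nat.card_pos hT1

theorem prod_le_ncard_ker_eq {F V L : Type*} [Field F] [Finite F] [AddCommGroup V] [Module F V]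
    [FiniteDimensional F V] [AddCommGroup L] [Module F L] [Finite L]
    (K : Submodule F V) {u : ℕ} (hK : Module.finrank F K + u = Module.finrank F V)
    (hu : u ≤ Module.finrank F L) :
    ∏ i : Fin u, (Nat.card F ^ Module.finrank F L - Nat.card F ^ (i : ℕ))
      ≤ {y : V →ₗ[F] L | LinearMap.ker y = K}.ncard := by
  have := Fintype.ofFinite F
  have : FiniteDimensional F L := Module.Finite.of_finite
  have : Finite (V →ₗ[F] L) := Module.finite_of_finite F
  rw [Nat.card_eq_fintype_card, ← card_linearIndependent hu]
  have hq : Module.finrank F (V ⧸ K) = u := by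
    have := K.finrank_quotient_add_finrank
    omega
  let b := Module.finBasisOfFinrankEq F (V ⧸ K) hq
  -- A linearly independent tuple prescribes an injective map on `V ⧸ K` by the images of a basis.
  let Φ : {v : Fin u → L // LinearIndependent F v} → {y : V →ₗ[F] L // LinearMap.ker y = K} :=
    fun v => ⟨(b.constr F v.1).comp K.mkQ, by
      have h : LinearMap.ker (b.constr F v.1) = ⊥ :=
        LinearMap.ker_eq_bot.2 (b.injective_constr_of_linearIndependent v.2)
      rw [LinearMap.ker_comp, h, ← LinearMap.ker, Submodule.ker_mkQ]⟩
  refine Nat.card_le_card_of_injective Φ fun v w hvw => Subtype.ext ?_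
  have h1 : (b.constr F v.1).comp K.mkQ = (b.constr F w.1).comp K.mkQ := congrArg Subtype.val hvw
  exact (b.constr F).injective ((LinearMap.cancel_right K.mkQ_surjective).1 h1)

/-- The decodable errors that vanish on a subspace `K` of codimension `u`, weighted by the number
of automorphisms of `F ^ t`, are few. Every such error is a codeword plus a map that factors
through a linear map `A` from `V` onto `F ^ t`; the pairs of an error and a map `A` are counted in
two ways. -/
theorem card_decodable_mul_le {F V L : Type*} [Field F] [AddCommGroup V] [Module F V]
    [FiniteDimensional F V] [AddCommGroup L] [Module F L] [Finite F] [Finite L]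
    (C : Set (V →ₗ[F] L)) {t u : ℕ}
    (hC : ∀ x ∈ C, ∀ y ∈ C, x ≠ y → 2 * t + 1 ≤ Module.finrank F (LinearMap.range (x - y)))
    {c₀ : V →ₗ[F] L} (hc₀ : c₀ ∈ C) (K : Submodule F V)
    (hK : Module.finrank F K + u = Module.finrank F V) :
    {y : V →ₗ[F] L | K ≤ LinearMap.ker y ∧
      ∃ c ∈ C, c ≠ c₀ ∧ Module.finrank F (LinearMap.range (c₀ + y - c)) ≤ t}.ncard
        * (∏ i : Fin t, (Nat.card F ^ t - Nat.card F ^ (i : ℕ))) * Nat.card L ^ t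
      ≤ Nat.card F ^ (Module.finrank F V * t) * Nat.card L ^ u := by
  classical
  have : FiniteDimensional F L := Module.Finite.of_finite
  have hfin : Finite (V →ₗ[F] L) := Module.finite_of_finite F
  have hfin' : Finite (V →ₗ[F] (Fin t → F)) := Module.finite_of_finite F
  set D := {y : V →ₗ[F] L | K ≤ LinearMap.ker y ∧
      ∃ c ∈ C, c ≠ c₀ ∧ Module.finrank F (LinearMap.range (c₀ + y - c)) ≤ t}
  let 𝒜 : Set (V →ₗ[F] (Fin t → F)) :=
    {A | Module.finrank F (LinearMap.ker A) + t = Module.finrank F V}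
  let r : (V →ₗ[F] L) → (V →ₗ[F] (Fin t → F)) → Prop := fun y A =>
    ∃ c ∈ C, c ≠ c₀ ∧ LinearMap.ker A ≤ LinearMap.ker (c₀ + y - c)
  have hcard𝒜 : 𝒜.ncard ≤ Nat.card F ^ (Module.finrank F V * t) := by
    refine (Set.ncard_le_card _).trans_eq ?_
    rw [Module.natCard_eq_pow_finrank (K := F), Module.finrank_linearMap,
      Module.finrank_fin_fun]
  have hpos : 0 < Nat.card L ^ t := pow_pos Nat.card_pos _
  have key := Finset.card_mul_le_card_mul (s := (Set.toFinite D).toFinset)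
    (t := (Set.toFinite 𝒜).toFinset) r
    (m := ∏ i : Fin t, (Nat.card F ^ t - Nat.card F ^ (i : ℕ)))
    (n := Nat.card L ^ u / Nat.card L ^ t)
    (fun y hy => by
      obtain ⟨-, c, hc, hcc, hr⟩ := (Set.Finite.mem_toFinset _).1 hy
      have h1 := (c₀ + y - c).finrank_range_add_finrank_ker
      have h2 := hC c hc c₀ hc₀ hcc
      have h3 := (c - c₀).finrank_range_add_finrank_ker
      obtain ⟨E, hE, hEd⟩ := (LinearMap.ker (c₀ + y - c)).exists_le_finrank_eq
        (d := Module.finrank F V - t) (by omega)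
      have h4 := prod_le_ncard_ker_eq (L := Fin t → F) E (u := t) (by omega) (by simp)
      rw [Module.finrank_fin_fun] at h4
      refine h4.trans ?_
      rw [← Set.ncard_coe_finset]
      refine Set.ncard_le_ncard (fun A hA => ?_) (Set.toFinite _)
      have hA' : LinearMap.ker A = E := hA
      simp only [Finset.coe_bipartiteAbove, Set.mem_ofPred_eq, Set.Finite.mem_toFinset]
      refine ⟨?_, c, hc, hcc, hA'.le.trans hE⟩
      change Module.finrank F (LinearMap.ker A) + t = _
      rw [hA']
      omega)
    (fun A hA => by
      have hA' : Module.finrank F (LinearMap.ker A) + t = Module.finrank F V :=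
        (Set.Finite.mem_toFinset (Set.toFinite 𝒜)).1 hA
      rw [Nat.le_div_iff_mul_le hpos]
      refine le_trans (Nat.mul_le_mul_right _ ?_)
        (card_vanishing_decodable_mul_le C hC hc₀ K (LinearMap.ker A) hK hA')
      rw [← Set.ncard_coe_finset]
      refine Set.ncard_le_ncard (fun y hy => ?_) (Set.toFinite _)
      simp only [Finset.coe_bipartiteBelow, Set.mem_ofPred_eq, Set.Finite.mem_toFinset] at hy
      exact ⟨hy.1.1, hy.2⟩)
  rw [← Set.ncard_eq_toFinset_card, ← Set.ncard_eq_toFinset_card] at key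
  calc _ ≤ 𝒜.ncard * (Nat.card L ^ u / Nat.card L ^ t) * Nat.card L ^ t :=
        Nat.mul_le_mul_right _ key
    _ = 𝒜.ncard * (Nat.card L ^ u / Nat.card L ^ t * Nat.card L ^ t) := mul_assoc _ _ _
    _ ≤ _ := Nat.mul_le_mul hcard𝒜 (Nat.div_mul_le_self _ _)

/-! ### The constant `K_q` and its finite versions -/

/-- The truncation `∏_{j=1}^{m} (1 - q^{-j})` of `rankConst q`. -/
noncomputable def truncRankConst (q m : ℕ) : ℝ :=
  ∏ j ∈ Finset.range m, (1 - ((q : ℝ) ^ (j + 1))⁻¹)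

theorem inv_pow_succ_lt_one {q : ℕ} (hq : 2 ≤ q) (j : ℕ) : ((q : ℝ) ^ (j + 1))⁻¹ < 1 :=
  inv_lt_one_of_one_lt₀ (one_lt_pow₀ (by exact_mod_cast hq) (Nat.succ_ne_zero j))

theorem truncRankConst_pos {q : ℕ} (hq : 2 ≤ q) (m : ℕ) : 0 < truncRankConst q m :=
  Finset.prod_pos fun j _ => sub_pos.2 (inv_pow_succ_lt_one hq j)

theorem truncRankConst_strictAnti {q : ℕ} (hq : 2 ≤ q) : StrictAnti (truncRankConst q) := by
  refine strictAnti_nat_of_succ_lt fun m => ?_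
  rw [truncRankConst, Finset.prod_range_succ]
  refine mul_lt_of_lt_one_right (truncRankConst_pos hq m) ?_
  have : (0 : ℝ) < ((q : ℝ) ^ (m + 1))⁻¹ := by positivity
  linarith

theorem summable_inv_pow_succ {q : ℕ} (hq : 2 ≤ q) :
    Summable fun j : ℕ => ((q : ℝ) ^ (j + 1))⁻¹ := by
  have h := summable_geometric_of_lt_one (r := (q : ℝ)⁻¹) (by positivity)
    (inv_lt_one_of_one_lt₀ (by exact_mod_cast hq))
  simpa [inv_pow] using (summable_nat_add_iff 1).2 h

theorem rankConst_pos {q : ℕ} (hq : 2 ≤ q) : 0 < rankConst q := by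
  have h := Real.summable_log_one_add_of_summable (summable_inv_pow_succ hq).neg
  have h' := Real.rexp_tsum_eq_tprod
    (fun j => by linarith [inv_pow_succ_lt_one hq j]) h
  simp only [← sub_eq_add_neg] at h'
  rw [rankConst, ← h']
  exact Real.exp_pos _

theorem rankConst_lt_truncRankConst {q : ℕ} (hq : 2 ≤ q) (m : ℕ) :
    rankConst q < truncRankConst q m := by
  have h := Real.multipliable_one_add_of_summable (summable_inv_pow_succ hq).neg
  simp only [← sub_eq_add_neg] at h
  refine lt_of_le_of_lt ?_ (truncRankConst_strictAnti hq (Nat.lt_succ_self m))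
  exact (truncRankConst_strictAnti hq).antitone.le_of_tendsto h.hasProd.tendsto_prod_nat (m + 1)

/-- The number of linearly independent `u`-tuples in an `m`-dimensional space is at least
`∏_{j=1}^{m} (1 - q^{-j})` times the number of all `u`-tuples. -/
theorem truncRankConst_mul_le_prod {q m u : ℕ} (hq : 2 ≤ q) (hu : u ≤ m) :
    truncRankConst q m * (q : ℝ) ^ (m * u)
      ≤ ((∏ i : Fin u, (q ^ m - q ^ (i : ℕ)) : ℕ) : ℝ) := by
  have hq0 : (q : ℝ) ≠ 0 := by positivity
  have h1 : ((∏ i : Fin u, (q ^ m - q ^ (i : ℕ)) : ℕ) : ℝ)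
      = (∏ i ∈ Finset.range u, (1 - ((q : ℝ) ^ (m - 1 - i + 1))⁻¹)) * (q : ℝ) ^ (m * u) := by
    rw [Fin.prod_univ_eq_prod_range (fun i => q ^ m - q ^ i), Nat.cast_prod, pow_mul,
      Finset.pow_eq_prod_const _ u, ← Finset.prod_mul_distrib]
    refine Finset.prod_congr rfl fun i hi => ?_
    have hi' := Finset.mem_range.1 hi
    have hpow : (q : ℝ) ^ m = (q : ℝ) ^ i * (q : ℝ) ^ (m - 1 - i + 1) := by
      rw [← pow_add]; congr 1; omega
    rw [Nat.cast_sub (Nat.pow_le_pow_right (by omega) (by omega)), Nat.cast_pow, Nat.cast_pow,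
      hpow]
    field_simp
  rw [h1, truncRankConst, ← Finset.prod_range_reflect]
  refine mul_le_mul_of_nonneg_right ?_ (by positivity)
  refine Finset.prod_le_prod_of_subset_of_le_one (Finset.range_mono hu) (fun i _ => ?_)
    (fun i _ _ => ?_)
  · exact sub_nonneg.2 (inv_pow_succ_lt_one hq _).le
  · exact sub_le_self _ (by positivity)

/-! ### Averaging over fibres -/

/-- If `p` is constant on the fibres of `k` and `s` fills at most the fraction `ε` of each fibre,
then `s` has probability at most `ε`. -/
theorem PMF.toReal_toOuterMeasure_le_of_fibers {α β : Type*} [Finite α] (p : PMF α) (k : α → β)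
    (hp : ∀ x y, k x = k y → p x = p y) (s : Set α) {ε : ℝ}
    (h : ∀ x, ((s ∩ {y | k y = k x}).ncard : ℝ) ≤ ε * ({y | k y = k x}.ncard : ℝ)) :
    (p.toOuterMeasure s).toReal ≤ ε := by
  classical
  have := Fintype.ofFinite α
  have hs : ∀ s : Set α, (p.toOuterMeasure s).toReal = ∑ x with x ∈ s, (p x).toReal := by
    intro s
    rw [PMF.toOuterMeasure_apply_fintype, ENNReal.toReal_sum
      (fun x _ => ne_top_of_le_ne_top (p.apply_ne_top x) (Set.indicator_le_self s p x)),
      Finset.sum_filter]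
    refine Finset.sum_congr rfl fun x _ => ?_
    by_cases hx : x ∈ s <;> simp [hx]
  have h1 : ∑ x, (p x).toReal = 1 := by
    have h2 := hs Set.univ
    rw [(p.toOuterMeasure_apply_eq_one_iff _).2 (Set.subset_univ _)] at h2
    simpa using h2.symm
  rw [hs, ← mul_one ε, ← h1,
    ← Finset.sum_fiberwise_of_maps_to (t := Finset.univ.image k) (g := k) (fun x _ => by simp),
    ← Finset.sum_fiberwise_of_maps_to (t := Finset.univ.image k) (g := k) (fun x _ => by simp),
    Finset.mul_sum]
  refine Finset.sum_le_sum fun b hb => ?_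
  obtain ⟨x, -, rfl⟩ := Finset.mem_image.1 hb
  rw [Finset.sum_congr rfl (g := fun _ => (p x).toReal)
      (fun y hy => by rw [hp y x (Finset.mem_filter.1 hy).2]),
    Finset.sum_congr rfl (s₁ := Finset.univ.filter fun y => k y = k x) (g := fun _ => (p x).toReal)
      (fun y hy => by rw [hp y x (Finset.mem_filter.1 hy).2]),
    Finset.sum_const, Finset.sum_const, nsmul_eq_mul, nsmul_eq_mul, ← mul_assoc]
  refine mul_le_mul_of_nonneg_right ?_ ENNReal.toReal_nonneg
  have e1 : (((Finset.univ.filter (· ∈ s)).filter (k · = k x) : Finset α) : Set α)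
      = s ∩ {y | k y = k x} := by
    ext y
    simp
  have e2 : ((Finset.univ.filter (k · = k x) : Finset α) : Set α) = {y | k y = k x} := by
    ext y
    simp
  rw [← Set.ncard_coe_finset, ← Set.ncard_coe_finset, e1, e2]
  exact h x

/-! ### Words as linear maps -/

/-- A word `x ∈ L ^ n` as the linear map `F ^ n → L` that sends the standard basis to its
entries. -/
noncomputable def wordEquiv (F L : Type*) [Field F] [Field L] [Algebra F L] (n : ℕ) :
    (Fin n → L) ≃ₗ[F] ((Fin n → F) →ₗ[F] L) :=
  (Pi.basisFun F (Fin n)).constr F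

theorem rankNorm_eq_finrank_range {F L : Type*} [Field F] [Field L] [Finite L] [Algebra F L]
    {n : ℕ} (x : Fin n → L) :
    rankNorm F x = Module.finrank F (LinearMap.range (wordEquiv F L n x)) := by
  rw [rankNorm, rank_toMatrix_eq_finrank_span, wordEquiv, Module.Basis.constr_range]

theorem minRankDist_le_rankDist {F L : Type*} [Field F] [Field L] [Finite L] [Algebra F L]
    {n : ℕ} {C : Set (Fin n → L)} {x y : Fin n → L} (hx : x ∈ C) (hy : y ∈ C) (hxy : x ≠ y) :
    minRankDist F C ≤ rankDist F x y :=
  Nat.sInf_le ⟨x, hx, y, hy, hxy, rfl⟩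

/-! ### The decodable fraction for a fixed kernel -/

/-- Among the maps with a given kernel `K`, a fraction of at most
`(∏_{j=1}^{m} (1 - q^{-j}))⁻² q^{-t²}` is decodable to a wrong codeword. -/
theorem card_decodable_ker_eq_le {F V L : Type*} [Field F] [AddCommGroup V] [Module F V]
    [FiniteDimensional F V] [AddCommGroup L] [Module F L] [Finite F] [Finite L]
    (hVL : Module.finrank F V ≤ Module.finrank F L)
    (C : Set (V →ₗ[F] L)) {t : ℕ}
    (hC : ∀ x ∈ C, ∀ y ∈ C, x ≠ y → 2 * t + 1 ≤ Module.finrank F (LinearMap.range (x - y)))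
    {c₀ : V →ₗ[F] L} (hc₀ : c₀ ∈ C) (K : Submodule F V) :
    ({y : V →ₗ[F] L | K ≤ LinearMap.ker y ∧
      ∃ c ∈ C, c ≠ c₀ ∧ Module.finrank F (LinearMap.range (c₀ + y - c)) ≤ t}.ncard : ℝ)
      ≤ (truncRankConst (Nat.card F) (Module.finrank F L) ^ 2)⁻¹
          * ((Nat.card F : ℝ) ^ (t ^ 2))⁻¹ * {y : V →ₗ[F] L | LinearMap.ker y = K}.ncard := by
  have : FiniteDimensional F L := Module.Finite.of_finite
  have hq : 2 ≤ Nat.card F := Finite.one_lt_card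
  have hL : Nat.card L = Nat.card F ^ Module.finrank F L := Module.natCard_eq_pow_finrank
  set D := {y : V →ₗ[F] L | K ≤ LinearMap.ker y ∧
    ∃ c ∈ C, c ≠ c₀ ∧ Module.finrank F (LinearMap.range (c₀ + y - c)) ≤ t}
  set κ := truncRankConst (Nat.card F) (Module.finrank F L) with hκ
  have hκ0 : 0 < κ := truncRankConst_pos hq _
  rcases D.eq_empty_or_nonempty with h0 | ⟨y, -, c, hc, hcc, -⟩
  · rw [h0, Set.ncard_empty, Nat.cast_zero]
    positivity
  have htm : t ≤ Module.finrank F L := by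
    have h2 := hC c hc c₀ hc₀ hcc
    have h3 := (c - c₀).finrank_range_add_finrank_ker
    omega
  obtain ⟨u, hu⟩ := Nat.exists_eq_add_of_le K.finrank_le
  have h1 := card_decodable_mul_le C hC hc₀ K hu.symm
  have h2 := prod_le_ncard_ker_eq (L := L) K hu.symm (by omega)
  have h3 := (truncRankConst_mul_le_prod hq (u := u) (m := Module.finrank F L) (by omega)).trans
    (Nat.cast_le.2 h2)
  have h4 := truncRankConst_mul_le_prod hq (le_refl t)
  have h5 : κ ≤ truncRankConst (Nat.card F) t := (truncRankConst_strictAnti hq).antitone htm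
  rw [← hκ] at h3
  have hqpos : (0 : ℝ) < (Nat.card F : ℝ) := by positivity
  have hq1 : (1 : ℝ) ≤ (Nat.card F : ℝ) := by exact_mod_cast hq.trans' one_le_two
  set g : ℕ := ∏ i : Fin t, (Nat.card F ^ t - Nat.card F ^ (i : ℕ))
  have hg' : κ * (Nat.card F : ℝ) ^ (t ^ 2) ≤ g := by
    rw [sq]
    exact (mul_le_mul_of_nonneg_right h5 (by positivity)).trans h4
  have h6 : (D.ncard : ℝ) * g * ((Nat.card F : ℝ) ^ (Module.finrank F L * t))
      ≤ (Nat.card F : ℝ) ^ (Module.finrank F L * u)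
        * (Nat.card F : ℝ) ^ (Module.finrank F L * t) := by
    have h7 : ((D.ncard * g * Nat.card L ^ t : ℕ) : ℝ) ≤ _ := Nat.cast_le.2 h1
    rw [hL, ← pow_mul, ← pow_mul] at h7
    push_cast at h7
    -- Here `dim V ≤ dim L` absorbs `q ^ (dim V * t)` into `|L| ^ t`.
    refine h7.trans ?_
    rw [mul_comm]
    gcongr
  have h8 := le_of_mul_le_mul_right h6 (by positivity)
  have h9 : (D.ncard : ℝ) * (κ * (Nat.card F : ℝ) ^ (t ^ 2))
      ≤ (Nat.card F : ℝ) ^ (Module.finrank F L * u) :=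
    (mul_le_mul_of_nonneg_left hg' (Nat.cast_nonneg _)).trans h8
  have h10 : (D.ncard : ℝ) * (κ ^ 2 * (Nat.card F : ℝ) ^ (t ^ 2))
      ≤ {y : V →ₗ[F] L | LinearMap.ker y = K}.ncard := by
    refine le_trans ?_ h3
    calc _ = κ * ((D.ncard : ℝ) * (κ * (Nat.card F : ℝ) ^ (t ^ 2))) := by ring
      _ ≤ _ := mul_le_mul_of_nonneg_left h9 hκ0.le
  rw [← mul_inv, ← div_eq_inv_mul, le_div_iff₀ (by positivity)]
  exact h10

/-! ### The decoder error probability -/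

theorem mainTheorem2 (F L : Type*) [Field F] [Finite F] [Field L] [Finite L] [Algebra F L]
    (n t : ℕ) (hn : n ≤ Module.finrank F L)
    (C : Set (Fin n → L)) (hC : IsMRD F C) (hd : minRankDist F C = 2 * t + 1)
    (dec : (Fin n → L) → Option (Fin n → L)) (hdec : IsBoundedRankDistanceDecoder F C t dec)
    (p : PMF (Fin n → L)) (hp : ∀ e e', rankNorm F e = rankNorm F e' → p e = p e')
    (c : Fin n → L) (hc : c ∈ C) :
    decoderErrorProb dec p c
      < (rankConst (Nat.card F) ^ 2)⁻¹ * ((Nat.card F : ℝ) ^ (t ^ 2))⁻¹ := by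
  have hq : 2 ≤ Nat.card F := Finite.one_lt_card
  have : Finite ((Fin n → F) →ₗ[F] L) := Module.finite_of_finite F
  let φ := wordEquiv F L n
  have hCφ : ∀ x ∈ φ '' C, ∀ y ∈ φ '' C, x ≠ y →
      2 * t + 1 ≤ Module.finrank F (LinearMap.range (x - y)) := by
    rintro _ ⟨x, hx, rfl⟩ _ ⟨y, hy, rfl⟩ hxy
    have h := minRankDist_le_rankDist (F := F) hx hy (fun h => hxy (congrArg φ h))
    rwa [hd, rankDist, rankNorm_eq_finrank_range, map_sub] at h
  have hle : decoderErrorProb dec p c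
      ≤ (truncRankConst (Nat.card F) (Module.finrank F L) ^ 2)⁻¹
        * ((Nat.card F : ℝ) ^ (t ^ 2))⁻¹ := by
    -- Errors with the same kernel have the same rank, so `p` is constant on the fibres.
    refine p.toReal_toOuterMeasure_le_of_fibers (fun e => LinearMap.ker (φ e)) ?_ _ fun x => ?_
    · intro e e' h
      refine hp e e' ?_
      rw [rankNorm_eq_finrank_range, rankNorm_eq_finrank_range]
      have h1 := (φ e).finrank_range_add_finrank_ker
      have h2 := (φ e').finrank_range_add_finrank_ker
      have h3 : Module.finrank F (LinearMap.ker (φ e)) = Module.finrank F (LinearMap.ker (φ e')) :=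
        congrArg (fun S : Submodule F (Fin n → F) => Module.finrank F S) h
      change Module.finrank F (LinearMap.range (φ e)) = Module.finrank F (LinearMap.range (φ e'))
      omega
    · have key := card_decodable_ker_eq_le (F := F) (V := Fin n → F) (L := L) (by simpa using hn)
        (φ '' C) hCφ (Set.mem_image_of_mem φ hc) (LinearMap.ker (φ x))
      have hfib : {y | LinearMap.ker (φ y) = LinearMap.ker (φ x)}.ncard
          = {y : (Fin n → F) →ₗ[F] L | LinearMap.ker y = LinearMap.ker (φ x)}.ncard :=
        Set.ncard_preimage_of_injective_subset_range
          (s := {y : (Fin n → F) →ₗ[F] L | LinearMap.ker y = LinearMap.ker (φ x)}) φ.injective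
          (fun y _ => φ.surjective y)
      rw [hfib]
      refine le_trans (Nat.cast_le.2 ?_) key
      rw [← Set.ncard_image_of_injective _ φ.injective]
      refine Set.ncard_le_ncard ?_ (Set.toFinite _)
      rintro _ ⟨y, ⟨⟨c', hy, hcc⟩, hker⟩, rfl⟩
      obtain ⟨hc', hdist⟩ := hdec.1 _ _ hy
      refine ⟨hker.ge, φ c', Set.mem_image_of_mem φ hc', fun h => hcc (φ.injective h), ?_⟩
      rwa [rankDist, rankNorm_eq_finrank_range, map_sub, map_add] at hdist
  refine hle.trans_lt ?_
  have h1 := rankConst_pos hq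
  have h2 := rankConst_lt_truncRankConst hq (Module.finrank F L)
  have h3 : (0 : ℝ) < ((Nat.card F : ℝ) ^ (t ^ 2))⁻¹ := by positivity
  gcongr
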